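/- **Setting.** Let $\mathcal H=(V,E)$ be a hypergraph: $V$ is a finite set and $E$ is a finite multiset of non-empty subsets of $V$. Its bipartite graph $\mathrm{Bip}\,\mathcal H$ has node classes $V$ (violet) and $E$ (emerald), with $v$ and $e$ adjacent if $v\in e$. Assume that $\mathrm{Bip}\,\mathcal H$ is connected, and fix a ribbon structure on it (a cyclic permutation of the incident edges at every node), a base node $b_0$ and a base edge $b_0b_1$. Subgraphs inherit the cyclic orders by restriction; $xy^+_G$ denotes the edge of $G$ that follows $xy$ at $x$. For $S\in\{V,E\}$, a vector $\mathbf f\colon S\to\mathbb Z_{\ge 0}$ is a hypertree on $S$ in a subgraph $G$ (on all the nodes) if $G$ has a spanning tree $T$ with $d_T(s)=\mathbf f(s)+1$ for all $s\in S$; then $T$ is said to realize $\mathbf f$. For a spanning tree $T$ of $\mathrm{Bip}\,\mathcal H$ put $\mathbf f_V(T)(v)=d_T(v)-1$, $v\in V$. **Process.** For $S\in\{V,E\}$, the (ht:$S$, cut:$V$) Bernardi process on a hypertree $\mathbf f$ on $S$ maintains a current graph, initially $\mathrm{Bip}\,\mathcal H$, and a current edge. The first current edge is $b_0b_1$ if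 $b_0\in V$; if $b_0\in E$ it is $b_1b_0^+$, and $b_0b_1$ counts as traversed from $b_0$. In a step with current graph $G$ and current edge $ve$ ($v\in V$, $e\in E$): if $\mathbf f$ is a hypertree on $S$ in $G-ve$, then $ve$ is removed, and the next current edge is $ve^+_G$. Otherwise $G$ is unchanged, $ve$ is traversed from $v$, then the edge $ew=ev^+_G$ is traversed from $e$, and the next current edge is $we^+_G$. The process stops right before an edge would be traversed for a second time from the same direction, and it yields the current graph at that moment. **Theorem.** Let $\mathbf f$ be a hypertree on $E$ in $\mathrm{Bip}\,\mathcal H$. The (ht:$E$, cut:$V$) Bernardi process on $\mathbf f$ stops, and the graph $T$ that it yields is a spanning tree of $\mathrm{Bip}\,\mathcal H$ realizing $\mathbf f$. Moreover, $T$ realizes $\mathbf f_V(T)$, which is thus a hypertree on $V$, and the (ht:$V$, cut:$V$) Bernardi process on $\mathbf f_V(T)$, with the same ribbon structure, base node and base edge, stops and yields $T$ again. -/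

import Mathlib

namespace HypergraphBernardi

/-- A hypergraph with vertex set `V` whose hyperedges, indexed by `E`, form a multiset of
non-empty subsets of `V` (distinct indices may carry the same subset). -/
structure HGraph (V E : Type*) where
  /-- the set of vertices of a hyperedge -/
  verts : E → Finset V
  nonempty : ∀ e, (verts e).Nonempty

/-- The underlying bipartite graph. Violet nodes are `Sum.inl v`, emerald nodes are
`Sum.inr e`, and `v` is joined to `e` when `v` belongs to `e`. -/
def HGraph.bip {V E : Type*} (H : HGraph V E) : SimpleGraph (V ⊕ E) where
  Adj
    | .inl v, .inr e => v ∈ H.verts e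
    | .inr e, .inl v => v ∈ H.verts e
    | _, _ => False
  symm := ⟨by
    rintro (v | e) (w | d) h <;> exact h⟩
  loopless := ⟨by
    rintro (v | e) h <;> exact h⟩

/-- A ribbon structure: at every node `x`, a cyclic permutation of the edges incident to `x`.
The edge `xy` at `x` is represented by its other endpoint `y`; the values of `next x` outside
the neighbours of `x` carry no information. -/
structure RibbonStructure {X : Type*} (B : SimpleGraph X) where
  /-- `next x y` is the other endpoint of the edge that follows `xy` at `x` -/
  next : X → Equiv.Perm X
  isCycleOn : ∀ x, (next x).IsCycleOn (B.neighborSet x)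

/-- The ribbon structure inherited by a subgraph `G`: for an edge `xy` of `G`, the other endpoint
of the edge `xy⁺` of `G`, i.e. of the first edge of `G` after `xy` in the cyclic order at `x`. -/
noncomputable def RibbonStructure.nextIn {X : Type*} {B : SimpleGraph X} (R : RibbonStructure B)
    (G : SimpleGraph X) (x y : X) : X :=
  (R.next x ^ sInf {k : ℕ | 0 < k ∧ G.Adj x ((R.next x ^ k) y)}) y

open Classical in
/-- `T` is a spanning tree of `G` (on the same node set as `G`). It realizes `f : S → ℕ`, where
`S` is the colour class included by `ι`, if its degree at every node of the class is `f + 1`. -/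
def IsRealization {X S : Type*} [Fintype X] (ι : S → X) (f : S → ℕ) (G T : SimpleGraph X) :
    Prop :=
  T ≤ G ∧ T.IsTree ∧ ∀ s, T.degree (ι s) = f s + 1

/-- `f` is a hypertree in `G` on the colour class included by `ι`. -/
def IsHypertree {X S : Type*} [Fintype X] (ι : S → X) (f : S → ℕ) (G : SimpleGraph X) : Prop :=
  ∃ T, IsRealization ι f G T

open Classical in
/-- The vector of degrees minus one of `T` on the colour class included by `ι`. -/
noncomputable def inducedVector {X S : Type*} [Fintype X] (ι : S → X) (T : SimpleGraph X) :
    S → ℕ :=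
  fun s => T.degree (ι s) - 1

/-- A state of the Bernardi process. -/
structure State (X : Type*) where
  /-- the current graph -/
  graph : SimpleGraph X
  /-- the endpoint of the current edge in the class where edges may be cut -/
  node : X
  /-- the other endpoint of the current edge -/
  other : X
  /-- `(x, y)` belongs to this set if the edge `xy` has been traversed from the direction
  of `x` -/
  traversed : Set (X × X)

open Classical in
/-- The initial state, where `cut` is the class of nodes at which edges may be cut and `b₀b₁` is
the base edge at the base node `b₀`. -/
noncomputable def initial {X : Type*} {B : SimpleGraph X} (R : RibbonStructure B) (cut : Set X)
    (b₀ b₁ : X) : State X :=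
  if b₀ ∈ cut then ⟨B, b₀, b₁, ∅⟩ else ⟨B, b₁, R.next b₁ b₀, {(b₀, b₁)}⟩

/-- One step of the Bernardi process with hypertree `f` on the class included by `ι`, at a state
with current graph `G` and current edge `xy`. If `f` is still a hypertree in `G - xy`, the edge
is removed and the edge after it at `x` becomes current. Otherwise `xy` is traversed from `x`,
then the edge `yw` after `yx` at `y` is traversed from `y`, and the edge after `wy` at `w` becomes
current; this is only done if neither traversal repeats an earlier one. -/
inductive Step {X S : Type*} [Fintype X] {B : SimpleGraph X} (R : RibbonStructure B)
    (ι : S → X) (f : S → ℕ) : State X → State X → Prop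
  | remove (G : SimpleGraph X) (x y : X) (τ : Set (X × X))
      (h : IsHypertree ι f (G.deleteEdges {s(x, y)})) :
      Step R ι f ⟨G, x, y, τ⟩ ⟨G.deleteEdges {s(x, y)}, x, R.nextIn G x y, τ⟩
  | traverse (G : SimpleGraph X) (x y w : X) (τ : Set (X × X))
      (h : ¬ IsHypertree ι f (G.deleteEdges {s(x, y)}))
      (hw : w = R.nextIn G y x) (hx : (x, y) ∉ τ) (hy : (y, w) ∉ τ) :
      Step R ι f ⟨G, x, y, τ⟩ ⟨G, w, R.nextIn G w y, τ ∪ {(x, y), (y, w)}⟩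

/-- The Bernardi process with hypertree `f` on the class included by `ι`, cutting at the class
`cut`, stops, and the current graph is `T` when it stops. It stops at a state where no step is
possible, that is, when an edge would be traversed a second time from the same direction. -/
def Yields {X S : Type*} [Fintype X] {B : SimpleGraph X} (R : RibbonStructure B)
    (b₀ b₁ : X) (cut : Set X) (ι : S → X) (f : S → ℕ) (T : SimpleGraph X) : Prop :=
  ∃ s : State X, Relation.ReflTransGen (Step R ι f) (initial R cut b₀ b₁) s ∧
    (∀ s', ¬ Step R ι f s s') ∧ s.graph = T

/-- The (ht:`E`, cut:`V`) Bernardi process on `f` yields `T`. -/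
def YieldsHtECutV {V E : Type*} [Fintype V] [Fintype E] (H : HGraph V E)
    (R : RibbonStructure H.bip) (b₀ b₁ : V ⊕ E) (f : E → ℕ) (T : SimpleGraph (V ⊕ E)) : Prop :=
  Yields R b₀ b₁ (Set.range Sum.inl) Sum.inr f T

/-- The (ht:`V`, cut:`V`) Bernardi process on `g` yields `T`. -/
def YieldsHtVCutV {V E : Type*} [Fintype V] [Fintype E] (H : HGraph V E)
    (R : RibbonStructure H.bip) (b₀ b₁ : V ⊕ E) (g : V → ℕ) (T : SimpleGraph (V ⊕ E)) : Prop :=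
  Yields R b₀ b₁ (Set.range Sum.inl) Sum.inl g T

end HypergraphBernardi

open SimpleGraph HypergraphBernardi

namespace HypergraphBernardi

variable {X : Type*} {B : SimpleGraph X}

/-! ### The tour of a subgraph of a ribbon graph -/

/-! The tour of a spanning tree `T` walks around it, crossing the edges of `T` and skipping all
others. Call `T` a Jaeger tree if every edge outside `T` is first seen from its end in the cutting
class `C`, here the violet one. Three facts carry the proof.

A hypertree off `C` is realized by some Jaeger tree (`exists_isJaeger`). Among the realizations,
take one whose sequence of decisions is lexicographically maximal. If a non-edge `ev` of `T` were
first seen from its end `e` outside `C`, it could be exchanged for the tree edge at `e` on the path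
to `v`. This keeps all degrees outside `C` and improves the sequence.

When the tour of a Jaeger tree reaches a tree edge from `C`, the process cannot remove it
(`IsJaeger.not_isHypertree`): the non-tree edges crossing the same cut in that direction are already
gone, and a count of degrees on the two sides rules out any other realization.

Hence the process follows the tour (`Follows`): it cuts exactly the edges outside `T`, as `T` itself
certifies those removals, and it ends with `T`. The Jaeger property mentions no hypertree and the
count works for either colour class, so the same tree is the outcome of both processes. The process
is deterministic, so there is no other outcome. -/

open Classical in
/-- The involution of the darts that reverses the darts of `T` and fixes all others. -/
noncomputable def crossing (T : SimpleGraph X) : Equiv.Perm (X × X) :=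
  Function.Involutive.toPerm (fun d => if T.Adj d.1 d.2 then d.swap else d) (by
    rintro ⟨a, b⟩
    by_cases h : T.Adj a b
    · simp [h, h.symm]
    · simp [h])

open Classical in
theorem crossing_apply (T : SimpleGraph X) (d : X × X) :
    crossing T d = if T.Adj d.1 d.2 then d.swap else d :=
  rfl

/-- One step of the tour of `T`: darts of `T` are traversed, and all other darts are skipped. -/
noncomputable def RibbonStructure.tour (R : RibbonStructure B) (T : SimpleGraph X) :
    Equiv.Perm (X × X) :=
  (crossing T).trans (Equiv.prodShear (Equiv.refl X) R.next)

/-- The dart seen at time `n` in the tour of `T` that starts from `d`. -/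
noncomputable def RibbonStructure.dart (R : RibbonStructure B) (T : SimpleGraph X) (d : X × X)
    (n : ℕ) : X × X :=
  (R.tour T ^ n) d

variable (R : RibbonStructure B) (T : SimpleGraph X) (d : X × X)

theorem RibbonStructure.tour_of_adj {x y : X} (h : T.Adj x y) :
    R.tour T (x, y) = (y, R.next y x) := by
  simp [tour, crossing_apply, h]

theorem RibbonStructure.tour_of_not_adj {x y : X} (h : ¬ T.Adj x y) :
    R.tour T (x, y) = (x, R.next x y) := by
  simp [tour, crossing_apply, h]

@[simp] theorem RibbonStructure.dart_zero : R.dart T d 0 = d := rfl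

theorem RibbonStructure.dart_succ (n : ℕ) : R.dart T d (n + 1) = R.tour T (R.dart T d n) := by
  simp [dart, pow_succ']

variable {R T d}

theorem RibbonStructure.dart_succ_of_adj {n : ℕ} {x y : X} (hn : R.dart T d n = (x, y))
    (h : T.Adj x y) : R.dart T d (n + 1) = (y, R.next y x) := by
  rw [R.dart_succ, hn, R.tour_of_adj T h]

theorem RibbonStructure.dart_succ_of_not_adj {n : ℕ} {x y : X} (hn : R.dart T d n = (x, y))
    (h : ¬ T.Adj x y) : R.dart T d (n + 1) = (x, R.next x y) := by
  rw [R.dart_succ, hn, R.tour_of_not_adj T h]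

theorem RibbonStructure.dart_add (n k : ℕ) :
    R.dart T d (n + k) = (R.tour T ^ k) (R.dart T d n) := by
  rw [dart, dart, add_comm, pow_add, Equiv.Perm.mul_apply]

theorem RibbonStructure.dart_add_congr {m n : ℕ} (h : R.dart T d m = R.dart T d n) (k : ℕ) :
    R.dart T d (m + k) = R.dart T d (n + k) := by
  rw [R.dart_add, R.dart_add, h]

theorem RibbonStructure.adj_next (R : RibbonStructure B) {x y : X} (h : B.Adj x y) :
    B.Adj x (R.next x y) :=
  (R.isCycleOn x).1.mapsTo h

theorem RibbonStructure.exists_next_pow_eq [Finite X] (R : RibbonStructure B) {x y z : X}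
    (hy : B.Adj x y) (hz : B.Adj x z) : ∃ k, (R.next x ^ k) y = z := by
  obtain ⟨k, hk⟩ := ((R.isCycleOn x).2 hy hz).exists_nat_pow_eq
  exact ⟨k, hk⟩

theorem RibbonStructure.dart_adj (hd : B.Adj d.1 d.2) (n : ℕ) :
    B.Adj (R.dart T d n).1 (R.dart T d n).2 := by
  induction n with
  | zero => exact hd
  | succ n ih =>
    obtain ⟨x, y, hn⟩ : ∃ x y, R.dart T d n = (x, y) := ⟨_, _, rfl⟩
    rw [hn] at ih
    by_cases h : T.Adj x y
    · rw [R.dart_succ_of_adj hn h]; exact R.adj_next ih.symm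
    · rw [R.dart_succ_of_not_adj hn h]; exact R.adj_next ih

variable (R T) in
theorem RibbonStructure.exists_period [Finite X] :
    ∃ N, 0 < N ∧ ∀ d n, R.dart T d (n + N) = R.dart T d n := by
  refine ⟨orderOf (R.tour T), orderOf_pos _, fun d n => ?_⟩
  rw [R.dart_add, pow_orderOf_eq_one, Equiv.Perm.one_apply]

/-- The tail of the tour changes only along darts of `T`. -/
theorem RibbonStructure.exists_crossing {P : X → Prop} {m n : ℕ} (hmn : m ≤ n)
    (hm : P (R.dart T d m).1) (hn : ¬ P (R.dart T d n).1) :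
    ∃ j a b, m ≤ j ∧ j < n ∧ R.dart T d j = (a, b) ∧ T.Adj a b ∧ P a ∧ ¬ P b := by
  induction n, hmn using Nat.le_induction with
  | base => exact absurd hm hn
  | succ n hmn ih =>
    by_cases hP : P (R.dart T d n).1
    · obtain ⟨x, y, hxy⟩ : ∃ x y, R.dart T d n = (x, y) := ⟨_, _, rfl⟩
      rw [hxy] at hP
      by_cases h : T.Adj x y
      · rw [R.dart_succ_of_adj hxy h] at hn
        exact ⟨n, x, y, hmn, n.lt_succ_self, hxy, h, hP, hn⟩
      · rw [R.dart_succ_of_not_adj hxy h] at hn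
        exact absurd hP hn
    · obtain ⟨j, a, b, h1, h2, h3⟩ := ih hP
      exact ⟨j, a, b, h1, h2.trans n.lt_succ_self, h3⟩

/-- `K` is a side of the edge `xy` of `T`, the one of `y`. -/
structure IsSide (T : SimpleGraph X) (x y : X) (K : Set X) : Prop where
  adj : T.Adj x y
  mem : y ∈ K
  notMem : x ∉ K
  eq_of_adj : ∀ a b, T.Adj a b → a ∈ K → b ∉ K → a = y ∧ b = x

theorem isSide_of_isAcyclic {x y : X} (hT : T.IsAcyclic) (h : T.Adj x y) :
    IsSide T x y {z | (T.deleteEdges {s(x, y)}).Reachable y z} := by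
  refine ⟨h, Reachable.refl _, fun hx => ?_, fun a b hab ha hb => ?_⟩
  · exact isBridge_iff.1 (isAcyclic_iff_forall_adj_isBridge.1 hT h) |>.elim (by simpa using hx.symm)
  · by_contra hne
    by_cases hs : s(a, b) = s(x, y)
    · rcases Sym2.eq_iff.1 hs with ⟨rfl, rfl⟩ | ⟨rfl, rfl⟩
      · exact hb (Reachable.refl _)
      · exact hne ⟨rfl, rfl⟩
    · exact hb (Reachable.trans ha (Adj.reachable (by simp [deleteEdges_adj, hab, hs])))

/-- After the tour enters a side of an edge, it sees all darts there before it leaves it. -/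
theorem RibbonStructure.exists_dart_of_side [Finite X] {x y a b : X} {K : Set X}
    (hK : IsSide T x y K) {n m : ℕ} (hn : R.dart T d n = (x, y)) (hnm : n < m)
    (hm : (R.dart T d m).1 ∉ K) (ha : a ∈ K) (hab : ∃ i, R.dart T d i = (a, b)) :
    ∃ i, n < i ∧ i < m ∧ R.dart T d i = (a, b) := by
  classical
  have hex : ∃ i, n < i ∧ R.dart T d i = (a, b) := by
    obtain ⟨i, hi⟩ := hab
    obtain ⟨N, hN, hper⟩ := R.exists_period T
    have : ∀ k, R.dart T d (i + k * N) = R.dart T d i := by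
      intro k
      induction k with
      | zero => simp
      | succ k ih => rw [Nat.succ_mul, ← add_assoc, hper, ih]
    exact ⟨i + (n + 1) * N, by nlinarith, (this _).trans hi⟩
  obtain ⟨h1, h2⟩ := Nat.find_spec hex
  have hmin := fun j => Nat.find_min (H := hex) (m := j)
  set i := Nat.find hex
  refine ⟨i, h1, ?_, h2⟩
  -- Otherwise the tour re-enters `K`, which it can only do by the dart `(x, y)`, at some time `j`.
  -- From `j` on it repeats what it did from `n` on, so `(a, b)` already appears at time `n + (i -
  -- j) < i`.
  by_contra! hmi
  obtain ⟨j, p, q, hj1, hj2, hj3, hpq, hp, hq⟩ :=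
    R.exists_crossing (T := T) (d := d) (P := fun z => z ∉ K) hmi hm (by simpa [h2] using ha)
  obtain ⟨rfl, rfl⟩ := hK.eq_of_adj q p hpq.symm (by simpa using hq) hp
  refine hmin (n + (i - j)) (by omega) ⟨by omega, ?_⟩
  rw [R.dart_add_congr (hn.trans hj3.symm), ← h2]
  congr 1; omega

/-- The tour of a spanning tree sees all darts. -/
theorem RibbonStructure.exists_dart_eq [Finite X] (hT : T.IsTree) (hd : B.Adj d.1 d.2)
    (hTB : T ≤ B) {a b : X} (hab : B.Adj a b) : ∃ i, R.dart T d i = (a, b) := by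
  obtain ⟨N, hN, hper⟩ := R.exists_period T
  -- After crossing to the side of `y`, the tour is back at `x` one period later, and the only way
  -- out of that side is `(y, x)`.
  have hswap : ∀ x y, T.Adj x y → (∃ i, R.dart T d i = (x, y)) →
      ∃ i, R.dart T d i = (y, x) := by
    rintro x y hxy ⟨i, hi⟩
    have hK := isSide_of_isAcyclic hT.isAcyclic hxy
    set K := {z | (T.deleteEdges {s(x, y)}).Reachable y z}
    obtain ⟨j, p, q, -, -, hj, hpq, hp, hq⟩ := R.exists_crossing (T := T) (d := d)
      (P := fun z => z ∈ K) (show i + 1 ≤ i + N by omega)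
      (by rw [R.dart_succ_of_adj hi hxy]; exact hK.mem) (by rw [hper, hi]; exact hK.notMem)
    obtain ⟨rfl, rfl⟩ := hK.eq_of_adj p q hpq hp hq
    exact ⟨j, hj⟩
  have hrot : ∀ x y, (∃ i, R.dart T d i = (x, y)) → ∃ i, R.dart T d i = (x, R.next x y) := by
    intro x y h
    by_cases hxy : T.Adj x y
    · obtain ⟨i, hi⟩ := hswap x y hxy h
      exact ⟨i + 1, R.dart_succ_of_adj hi hxy.symm⟩
    · obtain ⟨i, hi⟩ := h
      exact ⟨i + 1, R.dart_succ_of_not_adj hi hxy⟩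
  have hstar : ∀ x y z, B.Adj x y → B.Adj x z → (∃ i, R.dart T d i = (x, y)) →
      ∃ i, R.dart T d i = (x, z) := by
    intro x y z hy hz h
    obtain ⟨k, rfl⟩ := R.exists_next_pow_eq hy hz
    clear hz
    induction k with
    | zero => exact h
    | succ k ih => rw [pow_succ', Equiv.Perm.mul_apply]; exact hrot _ _ ih
  -- Seeing one dart at a node means seeing all of them; reversing tree darts carries this along
  -- paths of `T`.
  have hall : ∀ x z, T.Reachable x z → (∀ y, B.Adj x y → ∃ i, R.dart T d i = (x, y)) →
      ∀ y, B.Adj z y → ∃ i, R.dart T d i = (z, y) := by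
    rintro x z ⟨p⟩
    induction p with
    | nil => exact id
    | cons h p ih =>
      intro hx
      exact ih fun y hy => hstar _ _ y (hTB h).symm hy (hswap _ _ h (hx _ (hTB h)))
  exact hall d.1 a (hT.connected.preconnected _ _)
    (fun y hy => hstar _ _ _ hd hy ⟨0, rfl⟩) b hab

/-! ### Counting edges -/

/-- A forest extends to a spanning tree of the complete graph. -/
theorem card_edgeFinset_lt_of_isAcyclic {X : Type*} [Fintype X] [Nonempty X] {F : SimpleGraph X}
    [Fintype F.edgeSet] (hF : F.IsAcyclic) : F.edgeFinset.card + 1 ≤ Fintype.card X := by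
  classical
  obtain ⟨G, hFG, -, hG⟩ :=
    (connected_top (V := X)).exists_isTree_le_of_le_of_isAcyclic (le_top : F ≤ ⊤) hF
  rw [← hG.card_edgeFinset]
  exact Nat.succ_le_succ (Finset.card_le_card (edgeFinset_mono hFG))

theorem isBipartiteWith_filter_range {X S : Type*} [Fintype X] {ι : S → X} {F : SimpleGraph X}
    [DecidablePred (· ∈ Set.range ι)]
    (hbip : ∀ a b, F.Adj a b → (a ∈ Set.range ι ↔ b ∉ Set.range ι)) :
    F.IsBipartiteWith ((Finset.univ.filter (· ∈ Set.range ι) : Finset X) : Set X)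
      ((Finset.univ.filter (· ∉ Set.range ι) : Finset X) : Set X) where
  disjoint := by
    rw [Finset.disjoint_coe]
    exact Finset.disjoint_filter_filter_not _ _ _
  mem_of_adj a b h := by
    have := hbip a b h
    simp only [Finset.coe_filter, Finset.mem_univ, true_and, Set.mem_ofPred_eq]
    tauto

open Classical in
theorem sum_degree_eq_card_edgeFinset {X S : Type*} [Fintype X] [Fintype S] {ι : S → X}
    (hι : Function.Injective ι) {F : SimpleGraph X}
    (hbip : ∀ a b, F.Adj a b → (a ∈ Set.range ι ↔ b ∉ Set.range ι)) :
    ∑ s, F.degree (ι s) = F.edgeFinset.card := by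
  rw [← isBipartiteWith_sum_degrees_eq_card_edges (isBipartiteWith_filter_range hbip)]
  refine Finset.sum_bij (fun s _ => ι s) (by simp) (fun a _ b _ h => hι h) ?_ (by simp)
  intro b hb
  simpa using hb

open Classical in
/-- In a bipartite forest, the edges at those nodes of a class that lie in a set `K` form a forest
on `K`, if they do not leave `K`. -/
theorem sum_degree_lt_of_isAcyclic {X S : Type*} [Fintype X] [Fintype S] {ι : S → X}
    (hι : Function.Injective ι) {F : SimpleGraph X} (hF : F.IsAcyclic)
    (hbip : ∀ a b, F.Adj a b → (a ∈ Set.range ι ↔ b ∉ Set.range ι)) {K : Set X}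
    (hK : K.Nonempty) (hadj : ∀ s b, ι s ∈ K → F.Adj (ι s) b → b ∈ K) :
    ∑ s with ι s ∈ K, F.degree (ι s) + 1 ≤ K.ncard := by
  have : Nonempty K := hK.to_subtype
  refine le_of_le_of_eq (le_trans (Nat.succ_le_succ ?_)
    (card_edgeFinset_lt_of_isAcyclic (hF.induce K))) Nat.card_eq_fintype_card.symm
  let j : {s // ι s ∈ K} → K := fun s => ⟨ι s, s.2⟩
  have hj : Function.Injective j := fun a b h => Subtype.ext (hι (congrArg Subtype.val h))
  have hr : ∀ a : K, a ∈ Set.range j ↔ (a : X) ∈ Set.range ι := by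
    rintro ⟨a, ha⟩
    constructor
    · rintro ⟨s, hs⟩
      exact ⟨s, congrArg Subtype.val hs⟩
    · rintro ⟨s, rfl⟩
      exact ⟨⟨s, ha⟩, rfl⟩
  refine le_of_le_of_eq ?_ (sum_degree_eq_card_edgeFinset hj (F := F.induce K)
    (fun a b h => by rw [hr, hr]; exact hbip a b h))
  rw [Finset.sum_subtype (p := fun s => ι s ∈ K) _ (by simp)]
  refine Finset.sum_le_sum fun s _ => ?_
  rw [← card_neighborFinset_eq_degree, ← card_neighborFinset_eq_degree]
  refine (Finset.card_le_card ?_).trans_eq (Finset.card_map (Function.Embedding.subtype _))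
  intro b hb
  rw [mem_neighborFinset] at hb
  exact Finset.mem_map.2 ⟨⟨b, hadj s b s.2 hb⟩, by simpa [j] using hb, rfl⟩

/-- Two spanning trees cannot have the same degrees in a class if the first has no edges from nodes
of that class in `K` to the complement of `K`, and the second has no edges from nodes of that class
outside `K` to `K`. -/
theorem not_degree_eq_of_sides {X S : Type*} [Fintype X] [Fintype S] {ι : S → X}
    (hι : Function.Injective ι) {F F' : SimpleGraph X} (hF : F.IsTree) (hF' : F'.IsTree)
    (hbip : ∀ a b, F.Adj a b → (a ∈ Set.range ι ↔ b ∉ Set.range ι))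
    (hbip' : ∀ a b, F'.Adj a b → (a ∈ Set.range ι ↔ b ∉ Set.range ι)) {K : Set X}
    (hK : K.Nonempty) (hK' : Kᶜ.Nonempty) (hadj : ∀ s b, ι s ∈ K → F.Adj (ι s) b → b ∈ K)
    (hadj' : ∀ s b, ι s ∉ K → F'.Adj (ι s) b → b ∉ K) {f : S → ℕ} {G G' : SimpleGraph X}
    (hf : IsRealization ι f G F) (hf' : IsRealization ι f G' F') : False := by
  classical
  -- The two sides contribute at most `|K| - 1` and `|Kᶜ| - 1` to the degree sum over the class, but
  -- that sum is the number of edges of a spanning tree, `|X| - 1`.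
  have h1 := sum_degree_lt_of_isAcyclic hι hF.isAcyclic hbip hK hadj
  have h2 : ∑ s with ¬ ι s ∈ K, F.degree (ι s) + 1 ≤ Kᶜ.ncard := by
    refine le_of_eq_of_le ?_ (sum_degree_lt_of_isAcyclic hι hF'.isAcyclic hbip' hK' hadj')
    congr 1
    refine Finset.sum_congr (by ext; simp) fun s _ => ?_
    have h8 := hf.2.2 s
    have h9 := hf'.2.2 s
    simp only [← card_neighborFinset_eq_degree] at h8 h9 ⊢
    convert h8.trans h9.symm
  have h3 := sum_degree_eq_card_edgeFinset hι hbip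
  have h4 := hF.card_edgeFinset
  have h5 := Set.ncard_add_ncard_compl K
  have h6 : Nat.card X = Fintype.card X := Nat.card_eq_fintype_card
  have h8 := Finset.sum_filter_add_sum_filter_not Finset.univ (fun s => ι s ∈ K)
    (fun s => F.degree (ι s))
  omega

/-! ### Jaeger trees -/

/-- In the tour of `T` from `d`, every edge outside `T` is first seen from its node in `C`. -/
def IsJaeger (R : RibbonStructure B) (C : Set X) (d : X × X) (T : SimpleGraph X) : Prop :=
  ∀ n v e, v ∈ C → ¬ T.Adj e v → R.dart T d n = (e, v) → ∃ m < n, R.dart T d m = (v, e)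

open Classical in
/-- The decisions made in the tour of `T` from `d`: the preferred decision `true` is to leave out an
edge seen from its node in `C` and to use an edge seen from its node outside `C`. -/
noncomputable def decisions (R : RibbonStructure B) (C : Set X) (d : X × X) (T : SimpleGraph X)
    (n : ℕ) : Bool :=
  decide ((R.dart T d n).1 ∈ C ↔ ¬ T.Adj (R.dart T d n).1 (R.dart T d n).2)

/-- Take the first edge of the path from `e` to `v`; the rest of the path avoids `e`. -/
theorem exists_isSide_of_ne {T : SimpleGraph X} (hT : T.IsTree) {e v : X} (hne : e ≠ v) :
    ∃ w, T.Adj e w ∧ (T.deleteEdges {s(e, w)}).Reachable w v := by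
  classical
  obtain ⟨p, hp⟩ := hT.connected.exists_isPath e v
  cases p with
  | nil => exact absurd rfl hne
  | cons h q =>
    rw [Walk.cons_isPath_iff] at hp
    refine ⟨_, h, ⟨q.toDeleteEdge _ fun hq => hp.2 ?_⟩⟩
    exact q.fst_mem_support_of_mem_edges hq

theorem isTree_exchange {T : SimpleGraph X} (hT : T.IsTree) {e v w : X} (hw : T.Adj e w)
    (hv : (T.deleteEdges {s(e, w)}).Reachable w v) :
    (T.deleteEdges {s(e, w)} ⊔ edge e v).IsTree := by
  have hK := isSide_of_isAcyclic hT.isAcyclic hw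
  have hne : e ≠ v := by
    rintro rfl
    exact hK.notMem hv
  refine ⟨{ preconnected := fun a b => ?_, nonempty := hT.connected.nonempty }, ?_⟩
  · have h1 : (T.deleteEdges {s(e, w)} ⊔ edge e v).Reachable e w :=
      Reachable.trans (Adj.reachable (Or.inr (by simp [edge_adj, hne])))
        (hv.symm.mono le_sup_left)
    obtain ⟨p⟩ := hT.connected.preconnected a b
    induction p with
    | nil => exact Reachable.refl _
    | @cons a c b h p ih =>
      refine Reachable.trans ?_ ih
      by_cases hs : s(a, c) = s(e, w)
      · rcases Sym2.eq_iff.1 hs with ⟨rfl, rfl⟩ | ⟨rfl, rfl⟩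
        · exact h1
        · exact h1.symm
      · exact Adj.reachable (Or.inl (by simp [deleteEdges_adj, h, hs]))
  · exact (hT.isAcyclic.anti (deleteEdges_le _)).sup_edge_of_not_reachable
      fun h => hK.notMem (hv.trans h.symm)

/-- At `e` one edge replaces another, so only `v` and `w` change degree, and neither is in the
class. -/
theorem isRealization_exchange {S : Type*} [Fintype X] {ι : S → X} {f : S → ℕ}
    {T : SimpleGraph X} (hT : IsRealization ι f B T) {e v w : X} (hw : T.Adj e w)
    (hv : (T.deleteEdges {s(e, w)}).Reachable w v) (hev : B.Adj e v) (hTev : ¬ T.Adj e v)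
    (hιv : ∀ s, ι s ≠ v) (hιw : ∀ s, ι s ≠ w) :
    IsRealization ι f B (T.deleteEdges {s(e, w)} ⊔ edge e v) := by
  classical
  refine ⟨sup_le ((deleteEdges_le _).trans hT.1) ?_, isTree_exchange hT.2.1 hw hv, fun s => ?_⟩
  · intro a b hab
    rw [edge_adj] at hab
    rcases hab.1 with ⟨rfl, rfl⟩ | ⟨rfl, rfl⟩
    · exact hev
    · exact hev.symm
  · rw [← hT.2.2 s, ← card_neighborFinset_eq_degree, ← card_neighborFinset_eq_degree]
    have hv' := hιv s
    have hw' := hιw s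
    have hwv : w ≠ v := by
      rintro rfl
      exact hTev hw
    by_cases hs : ι s = e
    · have : ∀ _ : Fintype ((T.deleteEdges {s(e, w)} ⊔ edge e v).neighborSet (ι s)),
          (T.deleteEdges {s(e, w)} ⊔ edge e v).neighborFinset (ι s) =
          insert v ((T.neighborFinset (ι s)).erase w) := by
        intro _
        ext b
        have := hev.ne
        simp only [mem_neighborFinset, sup_adj, deleteEdges_adj, edge_adj, Finset.mem_insert,
          Finset.mem_erase, Set.mem_singleton_iff, Sym2.eq_iff, hs]
        grind
      rw [this, Finset.card_insert_of_notMem (by simp [hs, hTev]),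
        Finset.card_erase_add_one (by simpa [hs] using hw)]
    · congr 1
      ext b
      simp only [mem_neighborFinset, sup_adj, deleteEdges_adj, edge_adj,
        Set.mem_singleton_iff, Sym2.eq_iff]
      grind

/-- Some realization of a hypertree on the complement of `C` is a Jaeger tree. -/
theorem exists_isJaeger {S : Type*} [Fintype X] (R : RibbonStructure B) {C : Set X}
    (hC : ∀ x y, B.Adj x y → (x ∈ C ↔ y ∉ C)) {ι : S → X} (hι : ∀ s, ι s ∉ C) {f : S → ℕ}
    (hf : IsHypertree ι f B) {d : X × X} (hd : B.Adj d.1 d.2) :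
    ∃ T, IsRealization ι f B T ∧ IsJaeger R C d T := by
  classical
  -- The decision sequences are infinite, but there are only finitely many graphs, so a maximum
  -- exists.
  obtain ⟨T, hT, hmax⟩ := Set.exists_max_image {T | IsRealization ι f B T}
    (fun T => toLex (decisions R C d T)) (Set.toFinite _) hf
  refine ⟨T, hT, fun n v e hv hTev hn => ?_⟩
  by_contra! hseen
  have hev : B.Adj e v := by simpa [hn] using R.dart_adj (T := T) hd n
  have heC : e ∉ C := (hC v e hev.symm).1 hv
  obtain ⟨w, hw, hwv⟩ := exists_isSide_of_ne hT.2.1 hev.ne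
  have hK := isSide_of_isAcyclic hT.2.1.isAcyclic hw
  have hwC : w ∈ C := (hC w e (hT.1 hw).symm).2 heC
  have hT' := isRealization_exchange hT hw hwv hev hTev
    (fun s h => hι s (h ▸ hv)) (fun s h => hι s (h ▸ hwC))
  set T' := T.deleteEdges {s(e, w)} ⊔ edge e v with hT'def
  have hvw : v ≠ w := by
    rintro rfl
    exact hTev hw
  have hadj : ∀ a b, (a, b) ≠ (e, v) → (a, b) ≠ (v, e) → (a, b) ≠ (e, w) → (a, b) ≠ (w, e) →
      (T'.Adj a b ↔ T.Adj a b) := by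
    intro a b h1 h2 h3 h4
    simp only [hT'def, sup_adj, deleteEdges_adj, edge_adj, Set.mem_singleton_iff]
    grind
  have hT'ev : T'.Adj e v := Or.inr (by simp [edge_adj, hev.ne])
  have hT'ew : ¬ T'.Adj e w := by
    have := hw.ne
    simp only [hT'def, sup_adj, deleteEdges_adj, edge_adj, Set.mem_singleton_iff]
    grind
  -- The tours of `T` and `T'` agree up to the first time `m` that a dart of one of the two
  -- exchanged edges is seen. There `T'` makes the preferred decision and `T` does not, unless the
  -- dart is `(v, e)` or `(e, w)`; both are excluded.
  have hex : ∃ m, R.dart T d m ∈ ({(e, v), (v, e), (e, w), (w, e)} : Set (X × X)) :=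
    ⟨n, by simp [hn]⟩
  have hmn : Nat.find hex ≤ n := Nat.find_min' hex (by simp [hn])
  have hm := Nat.find_spec hex
  have hmin := fun j => Nat.find_min (H := hex) (m := j)
  set m := Nat.find hex
  have hadj' : ∀ j < m, (T'.Adj (R.dart T d j).1 (R.dart T d j).2 ↔
      T.Adj (R.dart T d j).1 (R.dart T d j).2) := by
    intro j hj
    have := hmin j hj
    simp only [Set.mem_insert_iff, Set.mem_singleton_iff, not_or] at this
    exact hadj _ _ this.1 this.2.1 this.2.2.1 this.2.2.2
  have hdart : ∀ j ≤ m, R.dart T' d j = R.dart T d j := by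
    intro j hj
    induction j with
    | zero => rfl
    | succ j ih =>
      have h1 := ih (by omega)
      have h2 := hadj' j (by omega)
      by_cases h : T.Adj (R.dart T d j).1 (R.dart T d j).2
      · rw [R.dart_succ_of_adj h1 (h2.2 h), R.dart_succ_of_adj rfl h]
      · rw [R.dart_succ_of_not_adj h1 (mt h2.1 h), R.dart_succ_of_not_adj rfl h]
  refine (hmax T' hT').not_gt ⟨m, fun j hj => ?_, ?_⟩
  · change decisions R C d T j = decisions R C d T' j
    rw [decisions, decisions, hdart j (le_of_lt hj), hadj' j hj]
  · change decisions R C d T m < decisions R C d T' m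
    rw [decisions, decisions, hdart m le_rfl]
    rcases hm with hm | hm | hm | hm
    · simp [hm, heC, hTev, hT'ev]
    · exact absurd hm (hseen m (lt_of_le_of_ne hmn (by
        intro h
        rw [h, hn] at hm
        exact hev.ne (congrArg Prod.fst hm))))
    · have hlt : m < n := lt_of_le_of_ne hmn (by
        intro h
        rw [h, hn] at hm
        exact hvw (congrArg Prod.snd hm))
      -- Having crossed `ew`, the tour sees `(v, e)` on the far side before it returns to `e`, so
      -- before `(e, v)`.
      obtain ⟨i, -, hi, h⟩ := R.exists_dart_of_side hK hm hlt
        (by rw [hn]; exact hK.notMem) hwv (R.exists_dart_eq hT.2.1 hd hT.1 hev.symm)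
      exact absurd h (hseen i hi)
    · rw [Set.mem_singleton_iff] at hm
      simp [hm, hwC, hw.symm, T'.adj_comm w e, hT'ew]

/-! ### Edges that cannot be removed -/

/-- When the tour of a Jaeger tree is about to traverse a tree edge, all other edges from the near
side of it to the far side with the near node in `C` have been seen from there. -/
theorem IsJaeger.exists_dart_of_side [Finite X] {R : RibbonStructure B} {C : Set X} {d : X × X}
    {T : SimpleGraph X} (hJ : IsJaeger R C d T) (hT : T.IsTree) (hTB : T ≤ B)
    (hd : B.Adj d.1 d.2) {n : ℕ} {x y : X} (hn : R.dart T d n = (x, y)) {K : Set X}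
    (hK : IsSide T x y K) {v e : X} (hv : v ∈ C) (hvK : v ∉ K) (heK : e ∈ K) (hve : B.Adj v e)
    (hTve : ¬ T.Adj v e) : ∃ m < n, R.dart T d m = (v, e) := by
  classical
  have hex := R.exists_dart_eq hT hd hTB hve
  have hm := Nat.find_spec hex
  have hmin := fun j => Nat.find_min (H := hex) (m := j)
  set m := Nat.find hex
  refine ⟨m, ?_, hm⟩
  by_contra! hnm
  have hne : n ≠ m := by
    intro h
    rw [h, hm] at hn
    obtain ⟨rfl, rfl⟩ := Prod.mk.inj hn
    exact hTve hK.adj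
  -- If `(v, e)` were first seen after `n`, the tour would see `(e, v)` inside `K` before that, and
  -- the Jaeger property would give a still earlier view of `(v, e)`.
  obtain ⟨i, -, hi, h⟩ := R.exists_dart_of_side hK hn (lt_of_le_of_ne hnm hne)
    (by rw [hm]; exact hvK) heK (R.exists_dart_eq hT hd hTB hve.symm)
  obtain ⟨j, hj, h'⟩ := hJ i v e hv (fun h => hTve h.symm) h
  exact hmin j (hj.trans hi) h'

/-- Let `K` be the side of `y`. The only edge of `T` across the cut has its end in `C` outside `K`,
while a tree `F` in `G - xy` can only cross with its end in `C` inside `K`. The degree count forbids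
both from realizing `f`. -/
theorem IsJaeger.not_isHypertree {S : Type*} [Fintype X] [Fintype S] {R : RibbonStructure B}
    {C : Set X} (hC : ∀ x y, B.Adj x y → (x ∈ C ↔ y ∉ C)) {d : X × X}
    {T : SimpleGraph X} (hJ : IsJaeger R C d T) {ι : S → X} (hι : Function.Injective ι)
    (hr : Set.range ι = C ∨ Set.range ι = Cᶜ) {f : S → ℕ} (hT : IsRealization ι f B T)
    (hd : B.Adj d.1 d.2) {n : ℕ} {x y : X} (hn : R.dart T d n = (x, y)) (hx : x ∈ C)
    (hxy : T.Adj x y) {G : SimpleGraph X} (hGB : G ≤ B)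
    (hG : ∀ v ∈ C, ∀ e, G.Adj v e → T.Adj v e ∨ ∀ m < n, R.dart T d m ≠ (v, e)) :
    ¬ IsHypertree ι f (G.deleteEdges {s(x, y)}) := by
  rintro ⟨F, hF⟩
  have hK := isSide_of_isAcyclic hT.2.1.isAcyclic hxy
  set K := {z | (T.deleteEdges {s(x, y)}).Reachable y z}
  have hFB : F ≤ B := (hF.1.trans (deleteEdges_le _)).trans hGB
  have hy : y ∉ C := (hC x y (hT.1 hxy)).1 hx
  have hFK : ∀ v ∈ C, ∀ e, F.Adj v e → e ∈ K → v ∈ K := by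
    intro v hv e hve heK
    by_contra hvK
    have hve' := hF.1 hve
    rw [deleteEdges_adj] at hve'
    by_cases hTve : T.Adj v e
    · obtain ⟨rfl, rfl⟩ := hK.eq_of_adj e v hTve.symm heK hvK
      exact hve'.2 rfl
    · obtain ⟨m, hm, h⟩ := hJ.exists_dart_of_side hT.2.1 hT.1 hd hn hK hv hvK heK (hFB hve) hTve
      exact ((hG v hv e hve'.1).resolve_left hTve) m hm h
  have hbip : ∀ a b, B.Adj a b → (a ∈ Set.range ι ↔ b ∉ Set.range ι) := by
    intro a b hab
    have := hC a b hab
    rcases hr with hr | hr <;> rw [hr]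
    · exact this
    · simp only [Set.mem_compl_iff]
      tauto
  have hKne : K.Nonempty := ⟨y, hK.mem⟩
  have hKne' : Kᶜ.Nonempty := ⟨x, hK.notMem⟩
  -- For the class `C` it is `T` whose class nodes in `K` send no edges out, and `F` whose class
  -- nodes outside send none in; for the complement of `C` the two trees swap roles.
  rcases hr with hr | hr
  · have hιC : ∀ s, ι s ∈ C := fun s => hr ▸ ⟨s, rfl⟩
    refine not_degree_eq_of_sides hι hT.2.1 hF.2.1 (fun a b h => hbip a b (hT.1 h))
      (fun a b h => hbip a b (hFB h)) hKne hKne' (fun s b hs h => ?_)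
      (fun s b hs h hb => hs (hFK _ (hιC s) b h hb)) hT hF
    by_contra hb
    exact hy ((hK.eq_of_adj _ _ h hs hb).1 ▸ hιC s)
  · have hιC : ∀ s, ι s ∉ C := fun s => by
      have : ι s ∈ Cᶜ := hr ▸ ⟨s, rfl⟩
      exact this
    refine not_degree_eq_of_sides hι hF.2.1 hT.2.1 (fun a b h => hbip a b (hFB h))
      (fun a b h => hbip a b (hT.1 h)) hKne hKne'
      (fun s b hs h => hFK b ((hC b _ (hFB h.symm)).2 (hιC s)) _ h.symm hs)
      (fun s b hs h hb => ?_) hF hT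
    exact hιC s ((hK.eq_of_adj _ _ h.symm hb hs).2 ▸ hx)

/-! ### The process follows the tour of a Jaeger tree -/

theorem RibbonStructure.nextIn_spec [Finite X] (R : RibbonStructure B) {G : SimpleGraph X}
    (hGB : G ≤ B) {x y z : X} (hy : B.Adj x y) (hz : G.Adj x z) :
    ∃ k, 0 < k ∧ R.nextIn G x y = (R.next x ^ k) y ∧ G.Adj x (R.nextIn G x y) ∧
      ∀ j, 0 < j → j < k → ¬ G.Adj x ((R.next x ^ j) y) := by
  obtain ⟨i, hi⟩ := R.exists_next_pow_eq hy (hGB hz)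
  have hne : {k : ℕ | 0 < k ∧ G.Adj x ((R.next x ^ k) y)}.Nonempty := by
    -- A full turn is added since `i` may be `0`; a nonempty set keeps `sInf` from its default
    -- value.
    refine ⟨i + orderOf (R.next x), Nat.add_pos_right _ (orderOf_pos _), ?_⟩
    rw [pow_add, pow_orderOf_eq_one, mul_one, hi]
    exact hz
  have h := Nat.sInf_mem hne
  exact ⟨_, h.1, rfl, h.2, fun j h0 hj hadj => Nat.notMem_of_lt_sInf hj ⟨h0, hadj⟩⟩

/-- A return to `y` after `k` rotations without meeting an edge of `G` would make the rotation
`k`-periodic at `y`, so `z` would never be met. This keeps the new current edge alive after `xy` is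
removed. -/
theorem RibbonStructure.nextIn_ne [Finite X] (R : RibbonStructure B) {G : SimpleGraph X}
    (hGB : G ≤ B) {x y z : X} (hy : B.Adj x y) (hz : G.Adj x z) (hzy : z ≠ y) :
    R.nextIn G x y ≠ y := by
  intro h
  obtain ⟨k, hk, hk', -, hmin⟩ := R.nextIn_spec hGB hy hz
  obtain ⟨i, hi⟩ := R.exists_next_pow_eq hy (hGB hz)
  have hi' : (R.next x ^ (i % k)) y = z := by
    rw [← hi]
    conv_rhs => rw [← Nat.mod_add_div i k, pow_add, pow_mul, Equiv.Perm.mul_apply,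
      Equiv.Perm.pow_apply_eq_self_of_apply_eq_self (hk'.symm.trans h)]
  rcases Nat.eq_zero_or_pos (i % k) with h0 | h0
  · rw [h0] at hi'
    exact hzy hi'.symm
  · exact hmin _ h0 (Nat.mod_lt _ hk) (hi'.symm ▸ hz)

/-- The tour of a subgraph of `G` skips all darts outside `G`. -/
theorem RibbonStructure.exists_dart_eq_nextIn [Finite X] {R : RibbonStructure B}
    {T G : SimpleGraph X} {d : X × X} (hTG : T ≤ G) (hGB : G ≤ B) {n : ℕ} {x y z : X}
    (hn : R.dart T d (n + 1) = (x, R.next x y)) (hy : B.Adj x y) (hz : G.Adj x z) :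
    ∃ k, 0 < k ∧ R.dart T d (n + k) = (x, R.nextIn G x y) ∧ G.Adj x (R.nextIn G x y) ∧
      ∀ j a b, n < j → j < n + k → R.dart T d j = (a, b) → a = x ∧ ¬ G.Adj a b := by
  obtain ⟨k, hk, hk', hadj, hmin⟩ := R.nextIn_spec hGB hy hz
  have key : ∀ j, 0 < j → j ≤ k → R.dart T d (n + j) = (x, (R.next x ^ j) y) := by
    intro j h0 hj
    induction j, h0 using Nat.le_induction with
    | base => simpa using hn
    | succ j h0 ih =>
      rw [← add_assoc, R.dart_succ_of_not_adj (ih (by omega))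
        (fun h => hmin j h0 (by omega) (hTG h)), pow_succ', Equiv.Perm.mul_apply]
  refine ⟨k, hk, hk' ▸ key k hk le_rfl, hadj, fun j a b h1 h2 h3 => ?_⟩
  obtain ⟨i, rfl⟩ := Nat.exists_eq_add_of_lt h1
  rw [add_assoc, key (i + 1) (by omega) (by omega)] at h3
  obtain ⟨rfl, rfl⟩ := Prod.mk.inj h3
  exact ⟨rfl, hmin _ (by omega) (by omega)⟩

/-- The state `s` of the process corresponds to time `n` in the tour of `T` from `d`. -/
structure Follows (R : RibbonStructure B) (C : Set X) (T : SimpleGraph X) (d : X × X) (n : ℕ)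
    (s : State X) : Prop where
  dart_eq : R.dart T d n = (s.node, s.other)
  node_mem : s.node ∈ C
  adj : s.graph.Adj s.node s.other
  le : s.graph ≤ B
  graph_adj : ∀ v ∈ C, ∀ e,
    s.graph.Adj v e ↔ B.Adj v e ∧ (T.Adj v e ∨ ∀ m < n, R.dart T d m ≠ (v, e))
  mem_traversed : ∀ p, p ∈ s.traversed ↔ ∃ m < n, R.dart T d m = p ∧ T.Adj p.1 p.2

/-- Once a dart repeats, the tour shows nothing new, and over all time it sees everything. -/
theorem RibbonStructure.exists_lt_dart_eq [Finite X] {R : RibbonStructure B} {T : SimpleGraph X}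
    {d : X × X} (hT : T.IsTree) (hTB : T ≤ B) (hd : B.Adj d.1 d.2) {m n : ℕ} (hmn : m < n)
    (h : R.dart T d m = R.dart T d n) {a b : X} (hab : B.Adj a b) :
    ∃ i < n, R.dart T d i = (a, b) := by
  classical
  have hex := R.exists_dart_eq hT hd hTB hab
  have hi := Nat.find_spec hex
  have hmin := fun j => Nat.find_min (H := hex) (m := j)
  set i := Nat.find hex
  refine ⟨i, ?_, hi⟩
  by_contra! hni
  refine hmin (m + (i - n)) (by omega) ?_
  rw [R.dart_add_congr h, ← hi]
  congr 1; omega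

theorem Follows.le_graph {R : RibbonStructure B}
    {C : Set X} (hC : ∀ x y, B.Adj x y → (x ∈ C ↔ y ∉ C)) {d : X × X} {T : SimpleGraph X}
    {n : ℕ} {s : State X} (hs : Follows R C T d n s) (hTB : T ≤ B) :
    T ≤ s.graph := by
  intro a b hab
  by_cases ha : a ∈ C
  · exact (hs.graph_adj a ha b).2 ⟨hTB hab, Or.inl hab⟩
  · have hb : b ∈ C := (hC b a (hTB hab).symm).2 ha
    exact ((hs.graph_adj b hb a).2 ⟨(hTB hab).symm, Or.inl hab.symm⟩).symm

theorem Follows.graph_eq {R : RibbonStructure B}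
    {C : Set X} (hC : ∀ x y, B.Adj x y → (x ∈ C ↔ y ∉ C)) {d : X × X} {T : SimpleGraph X}
    {n : ℕ} {s : State X} (hs : Follows R C T d n s) (hTB : T ≤ B)
    (h : ∀ v ∈ C, ∀ e, s.graph.Adj v e → ¬ T.Adj v e → ∃ m < n, R.dart T d m = (v, e)) :
    s.graph = T := by
  refine le_antisymm (fun a b hab => ?_) (hs.le_graph hC hTB)
  have key : ∀ v ∈ C, ∀ e, s.graph.Adj v e → T.Adj v e := by
    intro v hv e hve
    by_contra hT
    obtain ⟨m, hm, hm'⟩ := h v hv e hve hT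
    exact (((hs.graph_adj v hv e).1 hve).2.resolve_left hT) m hm hm'
  by_cases ha : a ∈ C
  · exact key a ha b hab
  · exact (key b ((hC b a (hs.le hab).symm).2 ha) a hab.symm).symm

/-- `T` still lies in the graph after the removal, so the removal is allowed. -/
theorem Follows.exists_step_of_not_adj {S : Type*} [Fintype X] {R : RibbonStructure B}
    {C : Set X} (hC : ∀ x y, B.Adj x y → (x ∈ C ↔ y ∉ C)) {d : X × X} {T : SimpleGraph X}
    {ι : S → X} {f : S → ℕ} (hT : IsRealization ι f B T)
    {n : ℕ} {s : State X} (hs : Follows R C T d n s)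
    (hTs : ¬ T.Adj s.node s.other) :
    ∃ n' s', n < n' ∧ Step R ι f s s' ∧ Follows R C T d n' s' := by
  classical
  have hle := hs.le_graph hC hT.1
  obtain ⟨G, x, y, τ⟩ := s
  have hn := hs.dart_eq
  have hx := hs.node_mem
  have hadj := hs.adj
  have hGB := hs.le
  have hG := hs.graph_adj
  have hτ := hs.mem_traversed
  dsimp only at *
  have hy : y ∉ C := (hC x y (hGB hadj)).1 hx
  have : Nontrivial X := ⟨x, y, hadj.ne⟩
  obtain ⟨z, hz⟩ := hT.2.1.connected.preconnected.exists_adj_of_nontrivial x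
  have hzy : z ≠ y := by
    rintro rfl
    exact hTs hz
  obtain ⟨k, hk, hk1, hk2, hk3⟩ := R.exists_dart_eq_nextIn hle hGB
    (R.dart_succ_of_not_adj hn hTs) (hGB hadj) (hle hz)
  have hne := R.nextIn_ne hGB (hGB hadj) (hle hz) hzy
  refine ⟨n + k, ⟨G.deleteEdges {s(x, y)}, x, R.nextIn G x y, τ⟩, by omega,
    Step.remove G x y τ ⟨T, fun a b hab => ?_, hT.2⟩, ⟨hk1, hx, ?_, ?_, ?_, ?_⟩⟩
  · rw [deleteEdges_adj]
    refine ⟨hle hab, fun h => hTs ?_⟩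
    rw [← mem_edgeSet, ← Set.mem_singleton_iff.1 h]
    exact hab
  · dsimp only
    rw [deleteEdges_adj]
    refine ⟨hk2, fun h => ?_⟩
    rcases Sym2.eq_iff.1 h with ⟨-, h⟩ | ⟨h, -⟩
    · exact hne h
    · exact hadj.ne h
  · exact (deleteEdges_le _).trans hGB
  · intro v hv e
    dsimp only
    rw [deleteEdges_adj, hG v hv e]
    constructor
    · rintro ⟨⟨h1, h2⟩, h3⟩
      refine ⟨h1, ?_⟩
      by_cases hTve : T.Adj v e
      · exact Or.inl hTve
      · refine Or.inr fun m hm hmve => ?_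
        rcases lt_trichotomy m n with hmn | rfl | hmn
        · exact h2.resolve_left hTve m hmn hmve
        · rw [hn] at hmve
          obtain ⟨rfl, rfl⟩ := Prod.mk.inj hmve
          exact h3 rfl
        · exact (hk3 m v e hmn hm hmve).2 ((hG v hv e).2 ⟨h1, h2⟩)
    · rintro ⟨h1, h2⟩
      refine ⟨⟨h1, h2.imp_right fun h m hm => h m (by omega)⟩, fun h => ?_⟩
      rcases Sym2.eq_iff.1 h with ⟨rfl, rfl⟩ | ⟨rfl, rfl⟩
      · exact h2.resolve_left hTs n (by omega) hn
      · exact hy hv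
  · intro p
    dsimp only
    rw [hτ]
    constructor
    · rintro ⟨m, hm, h⟩
      exact ⟨m, by omega, h⟩
    · rintro ⟨m, hm, h1, h2⟩
      rcases lt_trichotomy m n with hmn | rfl | hmn
      · exact ⟨m, hmn, h1, h2⟩
      · rw [hn] at h1
        subst h1
        exact absurd h2 hTs
      · exact absurd (hle h2) (hk3 m p.1 p.2 hmn hm h1).2

theorem Follows.exists_step_of_adj {S : Type*} [Fintype X] [Fintype S] {R : RibbonStructure B}
    {C : Set X} (hC : ∀ x y, B.Adj x y → (x ∈ C ↔ y ∉ C)) {d : X × X} {T : SimpleGraph X}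
    (hJ : IsJaeger R C d T) {ι : S → X} (hι : Function.Injective ι)
    (hr : Set.range ι = C ∨ Set.range ι = Cᶜ) {f : S → ℕ} (hT : IsRealization ι f B T)
    (hd : B.Adj d.1 d.2)
    {n : ℕ} {s : State X} (hs : Follows R C T d n s)
    (hTs : T.Adj s.node s.other) (hτs : (s.node, s.other) ∉ s.traversed) :
    ((∀ s', ¬ Step R ι f s s') ∧ s.graph = T) ∨
      ∃ n' s', n < n' ∧ Step R ι f s s' ∧ Follows R C T d n' s' := by
  have hle := hs.le_graph hC hT.1
  have hgraph := hs.graph_eq hC hT.1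
  have hrem := hJ.not_isHypertree hC hι hr hT hd hs.dart_eq hs.node_mem hTs hs.le
    (fun v hv e h => ((hs.graph_adj v hv e).1 h).2)
  obtain ⟨G, x, y, τ⟩ := s
  have hn := hs.dart_eq
  have hx := hs.node_mem
  have hGB := hs.le
  have hG := hs.graph_adj
  have hτ := hs.mem_traversed
  dsimp only at *
  have hy : y ∉ C := (hC x y (hT.1 hTs)).1 hx
  obtain ⟨k, hk, hk1, hk2, hk3⟩ := R.exists_dart_eq_nextIn hle hGB
    (R.dart_succ_of_adj hn hTs) (hT.1 hTs).symm (hle hTs).symm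
  obtain ⟨w, hw⟩ : ∃ w, w = R.nextIn G y x := ⟨_, rfl⟩
  rw [← hw] at hk1 hk2
  have hwC : w ∈ C := (hC w y (hGB hk2).symm).2 hy
  -- A non-tree edge `yw` would have been seen earlier from `w`, and so cut already; between times
  -- `n` and `n + k` the tour stays at `y`.
  have hTw : T.Adj y w := by
    by_contra hTw
    obtain ⟨m, hm, hm'⟩ := hJ (n + k) w y hwC hTw hk1
    have hwy := ((hG w hwC y).1 hk2.symm).2.resolve_left fun h => hTw h.symm
    rcases lt_trichotomy m n with hmn | rfl | hmn
    · exact hwy m hmn hm'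
    · rw [hn] at hm'
      obtain ⟨rfl, -⟩ := Prod.mk.inj hm'
      exact hTw hTs.symm
    · exact hy ((hk3 m w y hmn hm hm').1 ▸ hwC)
  by_cases hτw : (y, w) ∈ τ
  · refine Or.inl ⟨fun s' hs' => ?_, hgraph fun v hv e hve hTve => ?_⟩
    · cases hs' with
      | remove h => exact hrem ‹_›
      | traverse G x y w' τ h hw' hx' hy' =>
        exact hy' (hw'.trans hw.symm ▸ hτw)
    · obtain ⟨m, hm, hm', -⟩ := (hτ _).1 hτw
      obtain ⟨i, hi, hi'⟩ := R.exists_lt_dart_eq hT.2.1 hT.1 hd (show m < n + k by omega)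
        (hm'.trans hk1.symm) (hGB hve)
      refine ⟨i, ?_, hi'⟩
      rcases lt_trichotomy i n with hin | rfl | hin
      · exact hin
      · rw [hn] at hi'
        obtain ⟨rfl, rfl⟩ := Prod.mk.inj hi'
        exact absurd hTs hTve
      · exact absurd hve (hk3 i v e hin hi hi').2
  · obtain ⟨l, hl, hl1, hl2, hl3⟩ := R.exists_dart_eq_nextIn hle hGB
      (R.dart_succ_of_adj hk1 hTw) (hT.1 hTw).symm (hle hTw).symm
    refine Or.inr ⟨n + k + l, _, by omega, Step.traverse G x y w τ hrem hw hτs hτw,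
      ⟨hl1, hwC, hl2, hGB, ?_, ?_⟩⟩
    · intro v hv e
      refine ⟨fun h => ⟨hGB h, ?_⟩, fun h => ?_⟩
      · by_cases hTve : T.Adj v e
        · exact Or.inl hTve
        · refine Or.inr fun m hm hmve => ?_
          have h2 := ((hG v hv e).1 h).2.resolve_left hTve
          rcases lt_trichotomy m n with hmn | rfl | hmn
          · exact h2 m hmn hmve
          · rw [hn] at hmve
            obtain ⟨rfl, rfl⟩ := Prod.mk.inj hmve
            exact hTve hTs
          · rcases lt_trichotomy m (n + k) with hmk | rfl | hmk
            · exact (hk3 m v e hmn hmk hmve).2 h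
            · rw [hk1] at hmve
              obtain ⟨rfl, rfl⟩ := Prod.mk.inj hmve
              exact hTve hTw
            · exact (hl3 m v e hmk hm hmve).2 h
      · exact (hG v hv e).2 ⟨h.1, h.2.imp_right fun h m hm => h m (by omega)⟩
    · intro p
      dsimp only
      rw [Set.mem_union, hτ]
      constructor
      · rintro (⟨m, hm, h⟩ | rfl | h)
        · exact ⟨m, by omega, h⟩
        · exact ⟨n, by omega, hn, hTs⟩
        · rw [Set.mem_singleton_iff.1 h]
          exact ⟨n + k, by omega, hk1, hTw⟩
      · rintro ⟨m, hm, h1, h2⟩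
        rcases lt_trichotomy m n with hmn | rfl | hmn
        · exact Or.inl ⟨m, hmn, h1, h2⟩
        · exact Or.inr (Or.inl (h1.symm.trans hn))
        · rcases lt_trichotomy m (n + k) with hmk | rfl | hmk
          · exact absurd (hle h2) (hk3 m p.1 p.2 hmn hmk h1).2
          · exact Or.inr (Or.inr (h1.symm.trans hk1))
          · exact absurd (hle h2) (hl3 m p.1 p.2 hmk hm h1).2

theorem Follows.exists_reflTransGen {S : Type*} [Fintype X] [Fintype S] {R : RibbonStructure B}
    {C : Set X} (hC : ∀ x y, B.Adj x y → (x ∈ C ↔ y ∉ C)) {d : X × X} {T : SimpleGraph X}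
    (hJ : IsJaeger R C d T) {ι : S → X} (hι : Function.Injective ι)
    (hr : Set.range ι = C ∨ Set.range ι = Cᶜ) {f : S → ℕ} (hT : IsRealization ι f B T)
    (hd : B.Adj d.1 d.2)
    {n : ℕ} {s : State X} (hs : Follows R C T d n s) :
    ∃ s', Relation.ReflTransGen (Step R ι f) s s' ∧ (∀ s'', ¬ Step R ι f s' s'') ∧
      s'.graph = T := by
  obtain ⟨N, hN, hper⟩ := R.exists_period T
  induction hk : N - n using Nat.strong_induction_on generalizing n s with
  | _ k ih =>
    -- From time `N` on, the current dart is a repeat: a tree edge halts the process, and a non-tree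
    -- edge would already be cut. So `N - n` bounds the remaining steps.
    have hdart : N ≤ n → ∃ m < n, R.dart T d m = (s.node, s.other) := fun h =>
      ⟨n - N, by omega, by rw [← hs.dart_eq, ← hper d (n - N), Nat.sub_add_cancel h]⟩
    have key : ((∀ s', ¬ Step R ι f s s') ∧ s.graph = T) ∨
        n < N ∧ ∃ n' s', n < n' ∧ Step R ι f s s' ∧ Follows R C T d n' s' := by
      by_cases hTs : T.Adj s.node s.other
      · by_cases hτ : (s.node, s.other) ∈ s.traversed
        · refine Or.inl ⟨fun s' hs' => ?_, hs.graph_eq hC hT.1 fun v _ e hve _ => ?_⟩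
          · have hrem := hJ.not_isHypertree hC hι hr hT hd hs.dart_eq hs.node_mem hTs hs.le
              (fun v hv e h => ((hs.graph_adj v hv e).1 h).2)
            cases hs' with
            | remove G x y τ h => exact hrem h
            | traverse G x y w τ h hw hx hy => exact hx hτ
          · obtain ⟨m, hm, hm', -⟩ := (hs.mem_traversed _).1 hτ
            exact R.exists_lt_dart_eq hT.2.1 hT.1 hd hm (hm'.trans hs.dart_eq.symm) (hs.le hve)
        · refine (hs.exists_step_of_adj hC hJ hι hr hT hd hTs hτ).imp_right fun h => ⟨?_, h⟩
          by_contra! hn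
          obtain ⟨m, hm, hm'⟩ := hdart hn
          exact hτ ((hs.mem_traversed _).2 ⟨m, hm, hm', hTs⟩)
      · refine Or.inr ⟨?_, hs.exists_step_of_not_adj hC hT hTs⟩
        by_contra! hn
        obtain ⟨m, hm, hm'⟩ := hdart hn
        exact ((hs.graph_adj _ hs.node_mem _).1 hs.adj).2.resolve_left hTs m hm hm'
    rcases key with h | ⟨hnN, n', s', hn', hstep, hs'⟩
    · exact ⟨s, Relation.ReflTransGen.refl, h⟩
    · obtain ⟨t, ht, h⟩ := ih (N - n') (hk ▸ Nat.sub_lt_sub_left hnN hn') hs' rfl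
      exact ⟨t, Relation.ReflTransGen.head hstep ht, h⟩

theorem follows_initial {R : RibbonStructure B} {C : Set X}
    (hC : ∀ x y, B.Adj x y → (x ∈ C ↔ y ∉ C)) {b₀ b₁ : X} (hb : B.Adj b₀ b₁)
    {T : SimpleGraph X} (hJ : IsJaeger R C (b₀, b₁) T) :
    ∃ n, Follows R C T (b₀, b₁) n (initial R C b₀ b₁) := by
  by_cases h : b₀ ∈ C
  · refine ⟨0, ?_⟩
    rw [initial, if_pos h]
    exact ⟨rfl, h, hb, le_rfl, by simp, by simp⟩
  · have hb₁ : b₁ ∈ C := (hC b₁ b₀ hb.symm).2 h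
    -- A non-tree base edge would be first seen, at time `0`, from its end outside `C`.
    have hT : T.Adj b₀ b₁ := by
      by_contra hT
      obtain ⟨m, hm, -⟩ := hJ 0 b₁ b₀ hb₁ hT rfl
      exact absurd hm (Nat.not_lt_zero m)
    refine ⟨1, ?_⟩
    rw [initial, if_neg h]
    refine ⟨R.dart_succ_of_adj (n := 0) rfl hT, hb₁, R.adj_next hb.symm, le_rfl,
      fun v hv e => ?_, fun p => ?_⟩
    · have hne : (b₀, b₁) ≠ (v, e) := fun h' => h ((Prod.mk.inj h').1 ▸ hv)
      simp [hne]
    · constructor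
      · rintro rfl
        exact ⟨0, one_pos, rfl, hT⟩
      · rintro ⟨m, hm, rfl, -⟩
        obtain rfl : m = 0 := by omega
        rfl

/-! ### Determinism and outcome of the process -/

theorem step_rightUnique {S : Type*} [Fintype X] (R : RibbonStructure B) (ι : S → X) (f : S → ℕ) :
    Relator.RightUnique (Step R ι f) := by
  intro s t u ht hu
  cases ht with
  | remove G x y τ h =>
    cases hu with
    | remove => rfl
    | traverse _ _ _ _ _ h' => exact absurd h h'
  | traverse G x y w τ h hw =>
    cases hu with
    | remove _ _ _ _ h' => exact absurd h' h
    | traverse _ _ _ _ _ _ hw' => rw [hw, hw']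

theorem Yields.unique {S : Type*} [Fintype X] {R : RibbonStructure B} {b₀ b₁ : X} {C : Set X}
    {ι : S → X} {f : S → ℕ} {T T' : SimpleGraph X} (h : Yields R b₀ b₁ C ι f T)
    (h' : Yields R b₀ b₁ C ι f T') : T = T' := by
  obtain ⟨s, hs, hs1, rfl⟩ := h
  obtain ⟨t, ht, ht1, rfl⟩ := h'
  rcases Relation.ReflTransGen.total_of_right_unique (step_rightUnique R ι f) hs ht with h | h
  · rcases Relation.ReflTransGen.cases_head h with rfl | ⟨u, hu, -⟩
    · rfl
    · exact absurd hu (hs1 u)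
  · rcases Relation.ReflTransGen.cases_head h with rfl | ⟨u, hu, -⟩
    · rfl
    · exact absurd hu (ht1 u)

/-- The process on the vector realized by a Jaeger tree yields this tree. -/
theorem IsJaeger.yields {S : Type*} [Fintype X] [Fintype S] {R : RibbonStructure B} {C : Set X}
    (hC : ∀ x y, B.Adj x y → (x ∈ C ↔ y ∉ C)) {b₀ b₁ : X} (hb : B.Adj b₀ b₁)
    {T : SimpleGraph X} (hJ : IsJaeger R C (b₀, b₁) T) {ι : S → X} (hι : Function.Injective ι)
    (hr : Set.range ι = C ∨ Set.range ι = Cᶜ) {f : S → ℕ} (hT : IsRealization ι f B T) :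
    Yields R b₀ b₁ C ι f T := by
  obtain ⟨n, hn⟩ := follows_initial hC hb hJ
  exact hn.exists_reflTransGen hC hJ hι hr hT hb

/-- Degrees in a spanning tree on at least two nodes are positive, so the truncated subtraction
loses nothing. -/
theorem isRealization_inducedVector {S : Type*} [Fintype X] [Nontrivial X] (ι : S → X)
    {T : SimpleGraph X} (hT : T.IsTree) (hTB : T ≤ B) :
    IsRealization ι (inducedVector ι T) B T := by
  classical
  refine ⟨hTB, hT, fun s => ?_⟩
  have := hT.connected.preconnected.degree_pos_of_nontrivial (ι s)
  simp only [inducedVector, ← card_neighborFinset_eq_degree] at this ⊢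
  refine (Nat.sub_add_cancel (Nat.succ_le_of_lt ?_)).symm
  convert this

end HypergraphBernardi

theorem mainTheorem10 {V E : Type*} [Fintype V] [Fintype E]
    (H : HypergraphBernardi.HGraph V E) (hconn : H.bip.Connected)
    (R : HypergraphBernardi.RibbonStructure H.bip)
    (b₀ b₁ : V ⊕ E) (hbase : H.bip.Adj b₀ b₁)
    (f : E → ℕ) (hf : HypergraphBernardi.IsHypertree Sum.inr f H.bip) :
    (∃ T, HypergraphBernardi.YieldsHtECutV H R b₀ b₁ f T) ∧
    ∀ T, HypergraphBernardi.YieldsHtECutV H R b₀ b₁ f T →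
      HypergraphBernardi.IsRealization Sum.inr f H.bip T ∧
      HypergraphBernardi.IsRealization Sum.inl
        (HypergraphBernardi.inducedVector Sum.inl T) H.bip T ∧
      ∀ T', HypergraphBernardi.YieldsHtVCutV H R b₀ b₁
        (HypergraphBernardi.inducedVector Sum.inl T) T' ↔ T' = T := by
  have hC : ∀ x y, H.bip.Adj x y →
      (x ∈ Set.range (Sum.inl : V → V ⊕ E) ↔ y ∉ Set.range (Sum.inl : V → V ⊕ E)) := by
    rintro (v | e) (w | d) h
    · exact h.elim
    · simp
    · simp
    · exact h.elim
  have : Nontrivial (V ⊕ E) := ⟨b₀, b₁, hbase.ne⟩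
  obtain ⟨T, hT, hJ⟩ := exists_isJaeger R hC (by simp) hf (d := (b₀, b₁)) hbase
  have hy : YieldsHtECutV H R b₀ b₁ f T :=
    hJ.yields hC hbase Sum.inr_injective (Or.inr Set.isCompl_range_inl_range_inr.compl_eq.symm) hT
  refine ⟨⟨T, hy⟩, fun T₁ hT₁ => ?_⟩
  obtain rfl := hy.unique hT₁
  have hT' := isRealization_inducedVector (Sum.inl : V → V ⊕ E) hT.2.1 hT.1
  have hy' : YieldsHtVCutV H R b₀ b₁ (inducedVector Sum.inl T) T :=
    hJ.yields hC hbase Sum.inl_injective (Or.inl rfl) hT'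
  exact ⟨hT, hT', fun T' => ⟨fun h => h.unique hy', fun h => h ▸ hy'⟩⟩
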